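/- Let $\mathcal P$ be the class of ordered sets (partially ordered sets, possibly empty). Let $\mathcal P^{\mathrm{ct}}$ be the category of compact Hausdorff spaces equipped with a partial order that is closed in the product space (compact ordered spaces), let $\mathcal P^{\mathrm{Bt}}$ be its full subcategory of objects whose topology is zero-dimensional, and let $\mathcal P_{\mathscr T}$ be the category of Priestley spaces, that is, of isomorphic copies of topologically closed (possibly empty) substructures of powers of the two-element chain $\mathbb 2$ with the discrete topology; morphisms are the continuous order-preserving maps. For an ordered set $P$: - The Nachbin order-compactification $\beta_\le(P)$ is the closure of the image of $P$ under evaluation $p\mapsto (f(p))_f$ in $[0,1]^{F}$, where $F$ is the set of all order-preserving maps $f\colon P\to[0,1]$, with the subspace topology and the coordinatewise order. - The Bohr compactification $b(P)$ is the object of $\mathcal P^{\mathrm{ct}}$, with an order-embedding $\iota\colon P\to b(P)$ with dense image, such that for every $B\in\mathcal P^{\mathrm{ct}}$ and every order-preserving $g\colon P\to B$ there is a unique continuous order-preserving $h\colon b(P)\to B$ with $h\circ\iota=g$. The zero-dimensional Bohr compactification $b_0(P)$ is defined in the same way with $\mathcal P^{\mathrm{Bt}}$ in place of $\mathcal P^{\mathrm{ct}}$.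 - The natural extension $n_{\mathcal P}(P)$ is the closure of the image of $P$ under evaluation $p\mapsto (x(p))_x$ in $\mathbb 2^{\mathcal P(P,\mathbb 2)}$, where $\mathcal P(P,\mathbb 2)$ is the set of order-preserving maps $x\colon P\to\mathbb 2$, with the subspace topology and the coordinatewise order. Then for every ordered set $P$ $$\beta_\le(P)=b(P)=b_0(P)=n_{\mathcal P}(P),$$ where equality means: $\beta_\le(P)$ with its canonical map from $P$ has the defining properties of $b(P)$ and those of $b_0(P)$, it is a Priestley space, and there is an order-isomorphism and homeomorphism $\beta_\le(P)\to n_{\mathcal P}(P)$ commuting with the canonical maps from $P$. This coincidence is only weak: $\mathcal P_{\mathscr T}\subsetneq\mathcal P^{\mathrm{Bt}}\subsetneq\mathcal P^{\mathrm{ct}}$; in particular $\mathcal P_{\mathscr T}$ is not standard, i.e. there is a zero-dimensional compact ordered space that is not a Priestley space. -/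

import Mathlib

universe u

/-- The class `𝒫^ct`: ordered sets with a compact Hausdorff topology in which the order is closed
(compact ordered spaces). -/
structure IsCompactOrdered (X : Type u) [PartialOrder X] [TopologicalSpace X] : Prop where
  compact : CompactSpace X
  hausdorff : T2Space X
  closed_order : IsClosed {q : X × X | q.1 ≤ q.2}

/-- The class `𝒫^Bt`: compact ordered spaces whose topology is zero-dimensional (equivalently,
as they are compact Hausdorff, totally disconnected). -/
structure IsBooleanOrdered (X : Type u) [PartialOrder X] [TopologicalSpace X] : Prop extends
    IsCompactOrdered X where
  totallyDisconnected : TotallyDisconnectedSpace X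

/-- The class `𝒫_𝒯 = IS⁰_c P(𝟚_𝒯)`, that is, the Priestley spaces: ordered sets with topology that
are isomorphic to a topologically closed, possibly empty, substructure of some power of the
two-element chain `𝟚 = Bool` (`false < true`) with the discrete topology. -/
def IsPriestley (X : Type u) [PartialOrder X] [TopologicalSpace X] : Prop :=
  ∃ (I : Type u) (f : X → (I → Bool)),
    Topology.IsClosedEmbedding f ∧ ∀ x y : X, f x ≤ f y ↔ x ≤ y

/-- `(B, ι)` is the universal compactification of the ordered set `P` in the class `K` of ordered
sets with topology: `B` is in `K`, `ι` embeds the ordered set `P` as a dense subset of `B`, and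
each order-preserving map from `P` to a member of `K` factors uniquely through `ι` by a continuous
order-preserving map. -/
structure IsUniversalCompactification
    (K : ∀ (X : Type u) [PartialOrder X] [TopologicalSpace X], Prop)
    (P : Type u) [PartialOrder P] (B : Type u) [PartialOrder B] [TopologicalSpace B]
    (ι : P → B) : Prop where
  mem : K B
  embedding : ∀ p q : P, ι p ≤ ι q ↔ p ≤ q
  dense : DenseRange ι
  universal : ∀ (C : Type u) [PartialOrder C] [TopologicalSpace C], K C →
    ∀ g : P →o C, ∃! h : B →Co C, ∀ p : P, h (ι p) = g p

/-- `(B, ι)` is the Bohr compactification `b(P)` of the ordered set `P`. -/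
def IsBohrCompactification (P : Type u) [PartialOrder P] (B : Type u) [PartialOrder B]
    [TopologicalSpace B] (ι : P → B) : Prop :=
  IsUniversalCompactification (fun X _ _ => IsCompactOrdered X) P B ι

/-- `(B, ι)` is the zero-dimensional Bohr compactification `b₀(P)` of the ordered set `P`. -/
def IsZeroDimBohrCompactification (P : Type u) [PartialOrder P] (B : Type u) [PartialOrder B]
    [TopologicalSpace B] (ι : P → B) : Prop :=
  IsUniversalCompactification (fun X _ _ => IsBooleanOrdered X) P B ι

section Constructions

variable (P : Type u) [PartialOrder P]

/-- Evaluation of `P` at all order-preserving maps into `[0,1]` (for the discrete topology on `P`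
these are exactly the continuous order-preserving maps). -/
def nachbinEval (p : P) : (P →o unitInterval) → unitInterval := fun f => f p

/-- The Nachbin order-compactification of `P` (with the discrete topology): the closure of the
image of `P` in the cube `[0,1]^{𝒫(P, [0,1])}`, with the subspace topology and coordinatewise
order. -/
abbrev NachbinCompactification : Type u := ↥(closure (Set.range (nachbinEval P)))

/-- The canonical map from `P` to its Nachbin order-compactification. -/
def nachbinMap (p : P) : NachbinCompactification P :=
  ⟨nachbinEval P p, subset_closure (Set.mem_range_self p)⟩

/-- Evaluation of `P` at all order-preserving maps into the two-element chain. -/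
def natExtEval (p : P) : (P →o Bool) → Bool := fun f => f p

/-- The natural extension `n_𝒫(P)`: the closure of the image of `P` in the power
`𝟚_𝒯^{𝒫(P, 𝟚)}`, with the subspace topology and coordinatewise order. -/
abbrev NaturalExtension : Type u := ↥(closure (Set.range (natExtEval P)))

/-- The canonical map from `P` to its natural extension. -/
def natExtMap (p : P) : NaturalExtension P :=
  ⟨natExtEval P p, subset_closure (Set.mem_range_self p)⟩

end Constructions

/-!
Everything about `β_≤(P)` follows from one property: every upper set `W` of `P` is the trace of a
clopen upper set of `β_≤(P)`, namely the fibre over `1` of the coordinate belonging to the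
`{0,1}`-valued indicator of `W`. The natural extension has the same property, and
`isBohrCompactification_of_forall_upperSet` says that any compact ordered space containing `P`
densely with this property is the Bohr compactification. Indeed, in a compact ordered space `C`,
points `a ≰ b` have neighbourhoods no element of the first of which is below one of the second,
so an order-preserving `g : P → C` has, by `le_of_tendsto_of_forall_upperSet`, limits that depend
only on the point of the compactification, and monotonically so. No Urysohn-type embedding of `C`
into a cube is needed. Uniqueness of Bohr compactifications then identifies `β_≤(P)` with the
natural extension, which is Priestley by construction, and the zero-dimensional case is a
restriction of the universal property.

The unit interval is a compact ordered space that is not zero-dimensional. For a zero-dimensional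
one that is not Priestley, the chain of lower sets of `ℚ` is given its order topology, but the
partial order in which `s` is below `t` when `t` contains `s` and at most one more point. A
clopen upper set containing `∅` can never be left when moving up the chain
(`StralkaSpace.mem_of_isClopen_of_isUpperSet`): an exit would have to happen across a covering
pair of the chain, and covering pairs are comparable. Hence `∅` and the full set are not separated.
-/

open Filter Topology Set

/-! ### Compact ordered spaces and Priestley spaces -/

theorem IsCompactOrdered.of_isClosed {X : Type*} [PartialOrder X] [TopologicalSpace X]
    [CompactSpace X] [T2Space X] [OrderClosedTopology X] {S : Set X} (hS : IsClosed S) :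
    IsCompactOrdered S where
  compact := isCompact_iff_compactSpace.1 hS.isCompact
  hausdorff := inferInstance
  closed_order := isClosed_le continuous_fst continuous_snd

theorem orderClosedTopology_of_discreteTopology (X : Type*) [Preorder X] [TopologicalSpace X]
    [DiscreteTopology X] : OrderClosedTopology X :=
  ⟨isClosed_discrete _⟩

theorem IsPriestley.isBooleanOrdered {X : Type u} [PartialOrder X] [TopologicalSpace X]
    (h : IsPriestley X) : IsBooleanOrdered X := by
  obtain ⟨I, f, hf, hle⟩ := h
  have := orderClosedTopology_of_discreteTopology Bool
  refine ⟨⟨hf.compactSpace, hf.isEmbedding.t2Space, ?_⟩, ?_⟩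
  · have hc := hf.continuous
    have : IsClosed {q : X × X | f q.1 ≤ f q.2} := isClosed_le (by fun_prop) (by fun_prop)
    simpa only [hle] using this
  · exact ⟨hf.isEmbedding.isTotallyDisconnected
      (isTotallyDisconnected_of_totallyDisconnectedSpace _)⟩

/-- In a Priestley space, points not below one another are separated by a clopen upper set. -/
theorem IsPriestley.exists_isClopen_isUpperSet {X : Type u} [PartialOrder X] [TopologicalSpace X]
    (h : IsPriestley X) {x y : X} (hxy : ¬ x ≤ y) :
    ∃ U : Set X, IsClopen U ∧ IsUpperSet U ∧ x ∈ U ∧ y ∉ U := by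
  obtain ⟨I, f, hf, hle⟩ := h
  rw [← hle, Pi.le_def] at hxy
  push Not at hxy
  obtain ⟨i, hi⟩ := hxy
  have hc : Continuous fun z => f z i := (continuous_apply i).comp hf.continuous
  have hi' : f x i = true ∧ f y i = false := by
    revert hi; cases f x i <;> cases f y i <;> simp
  refine ⟨{z | f z i = true}, (isClopen_discrete {true}).preimage hc, ?_, hi'.1, by simp [hi'.2]⟩
  intro a b hab ha
  have := (hle a b).2 hab i
  simp only [mem_ofPred_eq] at ha ⊢
  rw [ha] at this
  exact top_le_iff.1 this

/-! ### Extension of order-preserving maps -/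

/-- Order-preserving maps into a space with closed order have monotone limits. If `a ≰ b`, then
`a` and `b` have neighbourhoods `A` and `B'` with no element of `A` below one of `B'`; the clopen
upper set whose trace on `P` is the upper closure of `g ⁻¹' A` contains `z`, hence `w`, so it
contains `ι q` for some `q` with `g q ∈ B'`, a contradiction. -/
theorem le_of_tendsto_of_forall_upperSet {P B C : Type*} [Preorder P] [Preorder B]
    [TopologicalSpace B] [Preorder C] [TopologicalSpace C] [OrderClosedTopology C] {ι : P → B}
    (hι : ∀ W : Set P, IsUpperSet W → ∃ D : Set B, IsClopen D ∧ IsUpperSet D ∧ ι ⁻¹' D = W)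
    {g : P → C} (hg : Monotone g) {z w : B} (hzw : z ≤ w) {u v : Filter P} [u.NeBot] [v.NeBot]
    (hu : Tendsto ι u (𝓝 z)) (hv : Tendsto ι v (𝓝 w)) {a b : C} (ha : Tendsto g u (𝓝 a))
    (hb : Tendsto g v (𝓝 b)) : a ≤ b := by
  by_contra hab
  have hopen : {q : C × C | ¬ q.1 ≤ q.2} ∈ 𝓝 (a, b) :=
    (isClosed_le continuous_fst continuous_snd).isOpen_compl.mem_nhds hab
  rw [nhds_prod_eq, mem_prod_iff] at hopen
  obtain ⟨A, hA, B', hB', hAB⟩ := hopen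
  obtain ⟨D, hD, hDup, hDW⟩ := hι (upperClosure (g ⁻¹' A)) (UpperSet.upper _)
  have hmem : ∀ p, ι p ∈ D ↔ p ∈ upperClosure (g ⁻¹' A) := fun p => by
    rw [← mem_preimage, hDW]; rfl
  have hz : z ∈ D := hD.1.mem_of_tendsto hu <| (ha.eventually_mem hA).mono
    fun p hp => (hmem p).2 (subset_upperClosure hp)
  obtain ⟨q, hqD, hqB⟩ := ((hv.eventually_mem (hD.2.mem_nhds (hDup hzw hz))).and
    (hb.eventually_mem hB')).exists
  obtain ⟨p, hpA, hpq⟩ := (hmem q).1 hqD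
  exact hAB (mk_mem_prod hpA hqB) (hg hpq)

/-- A compact ordered space containing `P` densely is its Bohr compactification as soon as each
upper set of `P` is the trace of a clopen upper set. -/
theorem isBohrCompactification_of_forall_upperSet {P B : Type u} [PartialOrder P]
    [PartialOrder B] [TopologicalSpace B] {ι : P → B} (hB : IsCompactOrdered B)
    (hmono : Monotone ι) (hd : DenseRange ι)
    (hι : ∀ W : Set P, IsUpperSet W → ∃ D : Set B, IsClopen D ∧ IsUpperSet D ∧ ι ⁻¹' D = W) :
    IsBohrCompactification P B ι where
  mem := hB
  embedding p q := by
    refine ⟨fun h => ?_, fun h => hmono h⟩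
    obtain ⟨D, -, hDup, hDW⟩ := hι (Ici p) (isUpperSet_Ici p)
    have hp : ι p ∈ D := by rw [← mem_preimage, hDW]; exact self_mem_Ici
    have hq := hDup h hp
    rwa [← mem_preimage, hDW] at hq
  dense := hd
  universal C _ _ hC g := by
    have := hC.compact
    have := hC.hausdorff
    have : OrderClosedTopology C := ⟨hC.closed_order⟩
    let : TopologicalSpace P := TopologicalSpace.induced ι inferInstance
    have di : IsDenseInducing ι := ⟨⟨rfl⟩, hd⟩
    have key : ∀ z, ∃ c, Tendsto g (comap ι (𝓝 z)) (𝓝 c) := fun z => by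
      have := di.comap_nhds_neBot z
      obtain ⟨c, hc⟩ := exists_clusterPt_of_compactSpace (map g (comap ι (𝓝 z)))
      refine ⟨c, le_nhds_of_unique_clusterPt fun c' hc' => ?_⟩
      -- Cluster points `c` and `c'` are both limits along ultrafilters on `P` converging to `z`.
      obtain ⟨u, hu, huc⟩ := mapClusterPt_iff_ultrafilter.1 hc
      obtain ⟨v, hv, hvc⟩ := mapClusterPt_iff_ultrafilter.1 hc'
      have hu' := tendsto_comap.mono_left hu
      have hv' := tendsto_comap.mono_left hv
      exact le_antisymm (le_of_tendsto_of_forall_upperSet hι g.monotone le_rfl hv' hu' hvc huc)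
        (le_of_tendsto_of_forall_upperSet hι g.monotone le_rfl hu' hv' huc hvc)
    have hlim : ∀ z, Tendsto g (comap ι (𝓝 z)) (𝓝 (di.extend g z)) := fun z =>
      tendsto_nhds_limUnder (key z)
    have hext : ∀ p, di.extend g (ι p) = g p := fun p => by
      refine tendsto_nhds_unique ((hlim (ι p)).mono_left ?_) (tendsto_pure_nhds g p)
      exact map_le_iff_le_comap.1 (pure_le_nhds (ι p))
    refine ⟨⟨⟨di.extend g, fun z w hzw => ?_⟩, di.continuous_extend key⟩, hext, fun h hh => ?_⟩
    · have := di.comap_nhds_neBot z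
      have := di.comap_nhds_neBot w
      exact le_of_tendsto_of_forall_upperSet hι g.monotone hzw tendsto_comap tendsto_comap
        (hlim z) (hlim w)
    · refine DFunLike.coe_injective (hd.equalizer h.continuous_toFun
        (di.continuous_extend key) (funext fun p => ?_))
      exact (hh p).trans (hext p).symm

/-- Bohr compactifications of `P` are unique up to isomorphism over `P`. -/
theorem IsBohrCompactification.exists_orderIso {P B B' : Type u} [PartialOrder P]
    [PartialOrder B] [TopologicalSpace B] [PartialOrder B'] [TopologicalSpace B'] {ι : P → B}
    {ι' : P → B'} (h : IsBohrCompactification P B ι) (h' : IsBohrCompactification P B' ι') :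
    ∃ e : B ≃o B', IsHomeomorph e ∧ ∀ p, e (ι p) = ι' p := by
  have := h.mem.hausdorff
  have := h'.mem.hausdorff
  obtain ⟨f, hf, -⟩ := h.universal B' h'.mem ⟨ι', fun p q hpq => (h'.embedding p q).2 hpq⟩
  obtain ⟨k, hk, -⟩ := h'.universal B h.mem ⟨ι, fun p q hpq => (h.embedding p q).2 hpq⟩
  change ∀ p, f (ι p) = ι' p at hf
  change ∀ p, k (ι' p) = ι p at hk
  have hfc : Continuous f := f.continuous_toFun
  have hkc : Continuous k := k.continuous_toFun
  have hkf : Function.LeftInverse k f := congrFun <|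
    h.dense.equalizer (hkc.comp hfc) continuous_id (funext fun p => by simp [hf, hk])
  have hfk : Function.RightInverse k f := congrFun <|
    h'.dense.equalizer (hfc.comp hkc) continuous_id (funext fun p => by simp [hf, hk])
  have hfm : Monotone f := f.monotone'
  have hkm : Monotone k := k.monotone'
  refine ⟨⟨⟨f, k, hkf, hfk⟩, fun {a b} => ⟨fun hab => ?_, fun hab => hfm hab⟩⟩,
    isHomeomorph_iff_exists_inverse.2 ⟨hfc, k, hkf, hfk, hkc⟩, hf⟩
  simpa [hkf a, hkf b] using hkm hab

theorem IsBohrCompactification.isZeroDimBohrCompactification {P B : Type u} [PartialOrder P]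
    [PartialOrder B] [TopologicalSpace B] {ι : P → B} (h : IsBohrCompactification P B ι)
    (hB : IsBooleanOrdered B) : IsZeroDimBohrCompactification P B ι where
  mem := hB
  embedding := h.embedding
  dense := h.dense
  universal C _ _ hC := h.universal C hC.toIsCompactOrdered

/-! ### The Nachbin compactification and the natural extension -/

/-- If the coordinate `f` is `⊤` on `W` and `t ≠ ⊤` off `W`, then it takes only these two values on
the closure of the image of `P`, so that its fibre over `⊤` is a clopen upper set with trace `W`. -/
theorem exists_isClopen_isUpperSet_of_indicator {P F T : Type*} [PartialOrder T] [OrderTop T]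
    [TopologicalSpace T] [T1Space T] (ev : P → F → T) (f : F) {W : Set P} {t : T} (ht : t ≠ ⊤)
    (hW : ∀ p ∈ W, ev p f = ⊤) (hW' : ∀ p ∉ W, ev p f = t) :
    ∃ D : Set (closure (range ev)), IsClopen D ∧ IsUpperSet D ∧
      (fun p => (⟨ev p, subset_closure (mem_range_self p)⟩ : closure (range ev))) ⁻¹' D = W := by
  have hc : Continuous fun z : closure (range ev) => z.1 f :=
    (continuous_apply f).comp continuous_subtype_val
  have hval : ∀ z : closure (range ev), z.1 f = ⊤ ∨ z.1 f = t := fun z => by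
    have hcl : IsClosed {x : F → T | x f ∈ ({⊤, t} : Set T)} :=
      (Set.toFinite {⊤, t}).isClosed.preimage (continuous_apply f)
    refine closure_minimal ?_ hcl z.2
    rintro _ ⟨p, rfl⟩
    by_cases hp : p ∈ W
    · exact Or.inl (hW p hp)
    · exact Or.inr (hW' p hp)
  refine ⟨{z | z.1 f = ⊤}, ⟨isClosed_singleton.preimage hc, ?_⟩, ?_, ?_⟩
  · have : {z : closure (range ev) | z.1 f = ⊤} = {z | z.1 f = t}ᶜ := by
      ext z
      rcases hval z with h | h <;> simp [h, ht, ht.symm]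
    rw [this]
    exact (isClosed_singleton.preimage hc).isOpen_compl
  · intro a b hab ha
    have hf : a.1 f ≤ b.1 f := hab f
    rw [show a.1 f = ⊤ from ha] at hf
    exact top_le_iff.1 hf
  · ext p
    by_cases hp : p ∈ W
    · simp [hp, hW p hp]
    · simp [hp, hW' p hp, ht]

/-- The order-preserving map that is `⊤` on the upper set `W` and `⊥` off it. -/
noncomputable def IsUpperSet.indicatorHom {P T : Type*} [Preorder P] [Preorder T] [BoundedOrder T]
    {W : Set P} (hW : IsUpperSet W) : P →o T where
  toFun := open Classical in fun p => if p ∈ W then ⊤ else ⊥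
  monotone' p q hpq := by
    by_cases hp : p ∈ W
    · simp [hp, hW hpq hp]
    · simp [hp]

theorem denseRange_codRestrict_closure {P X : Type*} [TopologicalSpace X] (ev : P → X) :
    DenseRange fun p => (⟨ev p, subset_closure (mem_range_self p)⟩ : closure (range ev)) := by
  intro z
  rw [closure_subtype, ← range_comp]
  exact z.2

theorem isBohrCompactification_nachbinMap (P : Type u) [PartialOrder P] :
    IsBohrCompactification P (NachbinCompactification P) (nachbinMap P) :=
  isBohrCompactification_of_forall_upperSet (.of_isClosed isClosed_closure)
    (fun _ _ hpq f => f.monotone hpq) (denseRange_codRestrict_closure _) fun _ hW =>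
    exists_isClopen_isUpperSet_of_indicator (nachbinEval P) hW.indicatorHom (t := ⊥) bot_ne_top
      (fun _ hp => if_pos hp) (fun _ hp => if_neg hp)

theorem isBohrCompactification_natExtMap (P : Type u) [PartialOrder P] :
    IsBohrCompactification P (NaturalExtension P) (natExtMap P) :=
  have := orderClosedTopology_of_discreteTopology Bool
  isBohrCompactification_of_forall_upperSet (.of_isClosed isClosed_closure)
    (fun _ _ hpq f => f.monotone hpq) (denseRange_codRestrict_closure _) fun _ hW =>
    exists_isClopen_isUpperSet_of_indicator (natExtEval P) hW.indicatorHom (t := ⊥) bot_ne_top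
      (fun _ hp => if_pos hp) (fun _ hp => if_neg hp)

theorem isPriestley_of_orderIso_naturalExtension {P X : Type u} [PartialOrder P] [PartialOrder X]
    [TopologicalSpace X] (e : X ≃o NaturalExtension P) (he : IsHomeomorph e) : IsPriestley X :=
  ⟨P →o Bool, fun x => (e x).1,
    isClosed_closure.isClosedEmbedding_subtypeVal.comp he.isClosedEmbedding,
    fun _ _ => e.le_iff_le⟩

/-! ### A zero-dimensional compact ordered space that is not Priestley -/

/-- `s.LeByOnePoint t`: the lower set `t` contains `s` and has at most one point more. -/
def LowerSet.LeByOnePoint {α : Type*} [LE α] (s t : LowerSet α) : Prop :=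
  s ≤ t ∧ ∀ p q : α, p ∈ t → p ∉ s → q ∈ t → q ∉ s → p = q

/-- Transitivity uses density: two points added one after the other would have a third one
between them. -/
theorem LowerSet.LeByOnePoint.trans {α : Type*} [LinearOrder α] [DenselyOrdered α]
    {s t r : LowerSet α} (hst : s.LeByOnePoint t) (htr : t.LeByOnePoint r) :
    s.LeByOnePoint r := by
  have main : ∀ p q : α, p < q → p ∉ s → q ∈ r → False := by
    intro p q hpq hps hqr
    obtain ⟨m, hpm, hmq⟩ := exists_between hpq
    have hms : m ∉ s := fun h => hps (s.lower hpm.le h)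
    have hmr : m ∈ r := r.lower hmq.le hqr
    by_cases hmt : m ∈ t
    · exact hpm.ne (hst.2 p m (t.lower hpm.le hmt) hps hmt hms)
    · exact hmq.ne (htr.2 m q hmr hmt hqr fun h => hmt (t.lower hmq.le h))
  refine ⟨hst.1.trans htr.1, fun p q hp hp' hq hq' => ?_⟩
  rcases lt_trichotomy p q with h | h | h
  · exact (main p q h hp' hq).elim
  · exact h
  · exact (main q p h hq' hp).elim

/-- The set of lower sets of a dense linear order `α`, topologised as a complete chain under
inclusion, but ordered by inclusion with at most one new point. The two orders differ, hence the
type synonym. For `α = ℚ` the space is an analogue of the Cantor set with each pair of endpoints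
of a removed interval ordered and no further relations, and it fails to be Priestley for the same
reason: identifying each point with those comparable to it yields a connected space. -/
def StralkaSpace (α : Type*) [LinearOrder α] : Type _ := LowerSet α

namespace StralkaSpace

variable {α : Type*} [LinearOrder α]

/-- The order topology of the chain of lower sets under inclusion. -/
instance : TopologicalSpace (StralkaSpace α) := Preorder.topology (LowerSet α)

/-- Inclusion of lower sets with at most one new point. -/
instance [DenselyOrdered α] : PartialOrder (StralkaSpace α) where
  le := LowerSet.LeByOnePoint
  le_refl s := ⟨le_refl (α := LowerSet α) s, fun _ _ h h' => absurd h h'⟩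
  le_trans _ _ _ := LowerSet.LeByOnePoint.trans
  le_antisymm _ _ hst hts := le_antisymm (α := LowerSet α) hst.1 hts.1

attribute [local instance] Preorder.topology in
theorem isClopen_setOf_mem (p : α) : IsClopen {s : LowerSet α | p ∈ s} := by
  have : OrderTopology (LowerSet α) := ⟨rfl⟩
  have h₁ : {s : LowerSet α | p ∈ s} = Ici (LowerSet.Iic p) := by ext s; simp
  have h₂ : {s : LowerSet α | p ∈ s} = Ioi (LowerSet.Iio p) := by
    ext s
    simp only [mem_ofPred_eq, mem_Ioi, ← not_le]
    refine ⟨fun h h' => lt_irrefl p (h' h), fun h => ?_⟩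
    by_contra hp
    refine h fun q hq => ?_
    exact lt_of_not_ge fun hpq => hp (s.lower hpq hq)
  exact ⟨h₁ ▸ isClosed_Ici, h₂ ▸ isOpen_Ioi⟩

theorem isBooleanOrdered (α : Type*) [LinearOrder α] [DenselyOrdered α] :
    IsBooleanOrdered (StralkaSpace α) := by
  let : TopologicalSpace (LowerSet α) := Preorder.topology _
  have : OrderTopology (LowerSet α) := ⟨rfl⟩
  have hcl : IsClosed {q : LowerSet α × LowerSet α | q.1.LeByOnePoint q.2} := by
    have heq : {q : LowerSet α × LowerSet α | q.1.LeByOnePoint q.2} = {q | q.1 ≤ q.2} ∩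
        ⋂ (p : α) (r : α), {q | p ∈ q.2 → p ∉ q.1 → r ∈ q.2 → r ∉ q.1 → p = r} := by
      ext q
      simp [LowerSet.LeByOnePoint]
    rw [heq]
    refine (isClosed_le continuous_fst continuous_snd).inter
      (isClosed_iInter fun p => isClosed_iInter fun r => ?_)
    have hc (a : α) :=
      (isClopen_setOf_mem a).preimage (continuous_fst (X := LowerSet α) (Y := LowerSet α))
    have hd (a : α) :=
      (isClopen_setOf_mem a).preimage (continuous_snd (X := LowerSet α) (Y := LowerSet α))
    by_cases hpr : p = r
    · simp [hpr]
    · have := ((hd p).inter ((hc p).compl.inter ((hd r).inter (hc r).compl))).compl.1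
      convert this using 1
      ext q
      simp [hpr]
  have hsep : TotallySeparatedSpace (LowerSet α) := by
    refine totallySeparatedSpace_iff_exists_isClopen.2 fun s t hst => ?_
    have : ∃ p, p ∈ s ∧ p ∉ t ∨ p ∉ s ∧ p ∈ t := by
      by_contra! h
      exact hst (LowerSet.ext (Set.ext fun p => ⟨fun hp => (h p).1 hp,
        fun hp => by_contra fun h' => (h p).2 h' hp⟩))
    obtain ⟨p, hp | hp⟩ := this
    · exact ⟨_, isClopen_setOf_mem p, hp.1, hp.2⟩
    · exact ⟨_, (isClopen_setOf_mem p).compl, hp.1, not_not.2 hp.2⟩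
  exact ⟨⟨inferInstanceAs (CompactSpace (LowerSet α)), inferInstanceAs (T2Space (LowerSet α)),
    hcl⟩, inferInstanceAs (TotallyDisconnectedSpace (LowerSet α))⟩

/-- A clopen upper set of a Stralka space that contains `∅` is everything. Its complement
would have a least element `m` in the chain, and the part below `m` a greatest element `l`; then
`m` covers `l` in the chain, so `m` has a single point more than `l` and lies above it. -/
theorem mem_of_isClopen_of_isUpperSet [DenselyOrdered α] {U : Set (StralkaSpace α)}
    (hU : IsClopen U) (hup : IsUpperSet U) (hbot : (⊥ : LowerSet α) ∈ U) (s : StralkaSpace α) :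
    s ∈ U := by
  let : TopologicalSpace (LowerSet α) := Preorder.topology _
  have : OrderTopology (LowerSet α) := ⟨rfl⟩
  by_contra hs
  let V : Set (LowerSet α) := U
  have hV : IsClopen V := hU
  obtain ⟨m, hm, hmin⟩ := hV.compl.1.isCompact.exists_isLeast ⟨s, hs⟩
  obtain ⟨l, ⟨hlV, hlm⟩, hmax⟩ :=
    (hV.1.inter (isClosed_Iic (a := m))).isCompact.exists_isGreatest ⟨⊥, hbot, bot_le (a := m)⟩
  have hno : ∀ r : LowerSet α, r ≤ m → r ≠ m → r ≤ l := fun r hr hne =>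
    hmax ⟨by_contra fun h => hne (le_antisymm hr (hmin h)), hr⟩
  have key : ∀ p q : α, p < q → p ∉ l → q ∈ m → False := fun p q hpq hp hq => by
    refine hp (hno (LowerSet.Iic p) ?_ ?_ le_rfl)
    · exact LowerSet.Iic_le.2 (m.lower hpq.le hq)
    · rintro rfl
      exact hpq.not_ge hq
  refine hm (hup (a := l) (b := m) ⟨hlm, fun p q hp hp' hq hq' => ?_⟩ hlV)
  rcases lt_trichotomy p q with h | h | h
  · exact (key p q h hp' hq).elim
  · exact h
  · exact (key q p h hq' hp).elim

theorem not_isPriestley (α : Type u) [LinearOrder α] [DenselyOrdered α] [Nontrivial α] :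
    ¬ IsPriestley (StralkaSpace α) := by
  intro h
  obtain ⟨a, b, hab⟩ := exists_pair_ne α
  have hnot : ¬ (LowerSet.LeByOnePoint (⊥ : LowerSet α) ⊤) := fun hle =>
    hab (hle.2 a b LowerSet.mem_top LowerSet.notMem_bot LowerSet.mem_top LowerSet.notMem_bot)
  obtain ⟨U, hU, hup, hbot, htop⟩ :=
    h.exists_isClopen_isUpperSet (x := (⊥ : LowerSet α)) (y := (⊤ : LowerSet α)) hnot
  exact htop (mem_of_isClopen_of_isUpperSet hU hup hbot _)

end StralkaSpace

/-! ### The unit interval -/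

theorem isCompactOrdered_ulift_unitInterval : IsCompactOrdered (ULift.{u} unitInterval) where
  compact := inferInstance
  hausdorff := inferInstance
  closed_order := isClosed_le (f := fun q : ULift.{u} unitInterval × ULift.{u} unitInterval =>
    q.1.down) (by fun_prop) (by fun_prop)

theorem not_isBooleanOrdered_ulift_unitInterval :
    ¬ IsBooleanOrdered (ULift.{u} unitInterval) := fun h => by
  have := h.totallyDisconnected
  have : TotallyDisconnectedSpace unitInterval :=
    ⟨Homeomorph.ulift.{u}.symm.isEmbedding.isTotallyDisconnected
      (isTotallyDisconnected_of_totallyDisconnectedSpace _)⟩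
  have := isPreconnected_univ.subsingleton (mem_univ (0 : unitInterval)) (mem_univ 1)
  exact zero_ne_one this

theorem proposition6p3 :
    -- the Nachbin order-compactification, `b`, `b₀` and the natural extension agree over `P`
    (∀ (P : Type u) [PartialOrder P],
      IsBohrCompactification P (NachbinCompactification P) (nachbinMap P) ∧
      IsZeroDimBohrCompactification P (NachbinCompactification P) (nachbinMap P) ∧
      IsPriestley (NachbinCompactification P) ∧
      ∃ e : NachbinCompactification P ≃o NaturalExtension P,
        IsHomeomorph e ∧ ∀ p : P, e (nachbinMap P p) = natExtMap P p) ∧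
    -- the three codomains are strictly nested
    (∀ (X : Type u) [PartialOrder X] [TopologicalSpace X], IsPriestley X → IsBooleanOrdered X) ∧
    (∃ (X : Type u) (_ : PartialOrder X) (_ : TopologicalSpace X),
      IsBooleanOrdered X ∧ ¬ IsPriestley X) ∧
    (∃ (X : Type u) (_ : PartialOrder X) (_ : TopologicalSpace X),
      IsCompactOrdered X ∧ ¬ IsBooleanOrdered X) := by
  refine ⟨fun P _ => ?_, fun X _ _ h => h.isBooleanOrdered, ?_,
    ⟨_, _, _, isCompactOrdered_ulift_unitInterval, not_isBooleanOrdered_ulift_unitInterval⟩⟩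
  · have hβ := isBohrCompactification_nachbinMap P
    obtain ⟨e, he, hep⟩ := hβ.exists_orderIso (isBohrCompactification_natExtMap P)
    have hP := isPriestley_of_orderIso_naturalExtension e he
    exact ⟨hβ, hβ.isZeroDimBohrCompactification hP.isBooleanOrdered, hP, e, he, hep⟩
  · have : DenselyOrdered (ULift.{u} ℚ) := ⟨fun a b hab =>
      let ⟨c, hac, hcb⟩ := exists_between (show a.down < b.down from hab)
      ⟨⟨c⟩, hac, hcb⟩⟩
    exact ⟨StralkaSpace (ULift.{u} ℚ), _, _, StralkaSpace.isBooleanOrdered _,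
      StralkaSpace.not_isPriestley _⟩
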